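/- Let $G$ be a locally compact group with left Haar measure $dt$, and let $\omega$ be a weight on $G$, i.e. a continuous function $\omega\colon G\to(0,\infty)$ with $\omega(st)\le\omega(s)\omega(t)$ for all $s,t\in G$ and $\omega(e)=1$. Let $A$ be a complex Banach algebra (not necessarily unital) and $X$ a Banach left $A$-module, whose action is a bounded bilinear map $A\times X\to X$ with $\|ax\|\le C\|a\|\|x\|$ for a constant $C$. For a complex Banach space $Y$ let $L^1_\omega(G,Y)$ be the Banach space of (classes of) Bochner $\omega\,dt$-integrable functions $f\colon G\to Y$ with $\|f\|=\int_G\|f(t)\|\,\omega(t)\,dt$, put $L^1_\omega(G)=L^1_\omega(G,\mathbb C)$, and let $\widehat\otimes$ denote the completed projective tensor product. Define convolution $L^1_\omega(G,A)\times L^1_\omega(G,X)\to L^1_\omega(G,X)$ as the bounded bilinear extension of $(f*g)(s)=\int_G f(t)\,g(t^{-1}s)\,dt$ for continuous compactly supported $f\colon G\to A$, $g\colon G\to X$ (and in the same way for $X=A$ and for $A=X=\mathbb C$), define the bounded bilinear product $(L^1_\omega(G)\widehat\otimes A)\times(L^1_\omega(G)\widehat\otimes X)\to L^1_\omega(G)\widehat\otimes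 X$ by $(f\otimes a)(g\otimes x)=(f*g)\otimes ax$ (and in the same way for $X=A$), and let $\alpha_Y\colon L^1_\omega(G)\widehat\otimes Y\to L^1_\omega(G,Y)$ be the bounded linear operator determined by $\alpha_Y(f\otimes y)(t)=f(t)y$. With these operations $L^1_\omega(G)\widehat\otimes A$ and $L^1_\omega(G,A)$ are Banach algebras, $L^1_\omega(G)\widehat\otimes X$ and $L^1_\omega(G,X)$ are Banach left modules over them, respectively (with the same constant $C$), and: (i) for every $u\in L^1_\omega(G)\widehat\otimes A$ and $v\in L^1_\omega(G)\widehat\otimes X$, $\alpha_X(uv)=\alpha_A(u)*\alpha_X(v)$; (ii) $\alpha_A$ is an isometric algebra isomorphism from $L^1_\omega(G)\widehat\otimes A$ onto $L^1_\omega(G,A)$. -/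

import Mathlib

open MeasureTheory TensorProduct CompactlySupported

noncomputable section

namespace Beurling

section ProjectiveTensorProduct

/-! The completed projective tensor product of two complex normed spaces. -/

variable {E F : Type*} [NormedAddCommGroup E] [NormedSpace ℂ E]
  [NormedAddCommGroup F] [NormedSpace ℂ F]

/-- The finite families `(xᵢ, yᵢ)` representing `u`, i.e. such that `u = ∑ xᵢ ⊗ yᵢ`. -/
def Reps (u : E ⊗[ℂ] F) : Set (List (E × F)) :=
  {l | (l.map fun p => p.1 ⊗ₜ[ℂ] p.2).sum = u}

/-- `∑ ‖xᵢ‖ ‖yᵢ‖`. -/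
def repCost {E F : Type*} [Norm E] [Norm F] (l : List (E × F)) : ℝ :=
  (l.map fun p => ‖p.1‖ * ‖p.2‖).sum

theorem mem_reps {u : E ⊗[ℂ] F} {l : List (E × F)} :
    l ∈ Reps u ↔ (l.map fun p => p.1 ⊗ₜ[ℂ] p.2).sum = u := Iff.rfl

theorem repCost_nonneg {E F : Type*} [NormedAddCommGroup E] [NormedAddCommGroup F]
    (l : List (E × F)) : 0 ≤ repCost l := by
  refine List.sum_nonneg fun a ha => ?_
  obtain ⟨p, -, rfl⟩ := List.mem_map.1 ha
  positivity

theorem reps_nonempty (u : E ⊗[ℂ] F) : (Reps u).Nonempty := by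
  induction u using TensorProduct.induction_on with
  | zero => exact ⟨[], by simp [Reps]⟩
  | tmul x y => exact ⟨[(x, y)], by simp [Reps]⟩
  | add u v hu hv =>
    obtain ⟨l, hl⟩ := hu
    obtain ⟨m, hm⟩ := hv
    refine ⟨l ++ m, ?_⟩
    rw [mem_reps] at hl hm ⊢
    rw [List.map_append, List.sum_append, hl, hm]

instance (u : E ⊗[ℂ] F) : Nonempty (Reps u) := (reps_nonempty u).to_subtype

/-- The value of the projective norm at `u`: the infimum of `∑ ‖xᵢ‖ ‖yᵢ‖` over all
representations `u = ∑ xᵢ ⊗ yᵢ`. -/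
def projNorm (u : E ⊗[ℂ] F) : ℝ := ⨅ l : Reps u, repCost l.1

theorem bddBelow_repCost (u : E ⊗[ℂ] F) :
    BddBelow (Set.range fun l : Reps u => repCost l.1) :=
  ⟨0, by rintro _ ⟨l, rfl⟩; exact repCost_nonneg _⟩

theorem projNorm_le_repCost (l : List (E × F)) (u : E ⊗[ℂ] F) (h : l ∈ Reps u) :
    projNorm u ≤ repCost l :=
  ciInf_le (bddBelow_repCost u) ⟨l, h⟩

variable (E F) in
/-- The projective norm as a seminorm. -/
def projSeminorm : Seminorm ℂ (E ⊗[ℂ] F) := .ofSMulLE projNorm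
  (le_antisymm ((projNorm_le_repCost [] 0 (by simp [Reps])).trans_eq (by simp [repCost]))
    (le_ciInf fun l => repCost_nonneg l.1))
  (fun u v => le_ciInf_add_ciInf fun p q => by
    refine (projNorm_le_repCost (p.1 ++ q.1) (u + v) ?_).trans_eq (by simp [repCost])
    have hp := p.2
    have hq := q.2
    rw [mem_reps] at hp hq ⊢
    rw [List.map_append, List.sum_append, hp, hq])
  (fun c u => by
    change _ ≤ ‖c‖ * ⨅ l : Reps u, repCost l.1
    rw [Real.mul_iInf_of_nonneg (norm_nonneg _)]
    refine le_ciInf fun p => ?_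
    refine (projNorm_le_repCost (p.1.map fun q => (c • q.1, q.2)) (c • u) ?_).trans_eq ?_
    · have hp := p.2
      rw [mem_reps] at hp ⊢
      refine Eq.trans ?_ (congrArg (c • ·) hp)
      simp [List.map_map, Function.comp_def, TensorProduct.smul_tmul', List.smul_sum]
    · simp [repCost, List.map_map, Function.comp_def, norm_smul, mul_assoc,
        List.sum_map_mul_left])

variable (E F) in
/-- The algebraic tensor product `E ⊗ F` over `ℂ`, endowed with the projective norm. -/
def ProjAlg : Type _ := E ⊗[ℂ] F

instance : AddCommGroup (ProjAlg E F) := inferInstanceAs (AddCommGroup (E ⊗[ℂ] F))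

instance : Module ℂ (ProjAlg E F) := inferInstanceAs (Module ℂ (E ⊗[ℂ] F))

variable (E F) in
/-- The identity map from `E ⊗ F` to the same space with the projective norm. -/
def toProjAlg : E ⊗[ℂ] F ≃ₗ[ℂ] ProjAlg E F := LinearEquiv.refl ℂ (E ⊗[ℂ] F)

instance : SeminormedAddCommGroup (ProjAlg E F) :=
  AddGroupSeminorm.toSeminormedAddCommGroup (E := ProjAlg E F)
    ((projSeminorm E F).comp (toProjAlg E F).symm.toLinearMap).toAddGroupSeminorm

instance : NormedSpace ℂ (ProjAlg E F) :=
  ⟨fun c u => (((projSeminorm E F).comp (toProjAlg E F).symm.toLinearMap).smul' c u).le⟩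

theorem norm_toProjAlg (u : E ⊗[ℂ] F) : ‖toProjAlg E F u‖ = projNorm u := rfl

variable (E F) in
/-- The projective tensor product: the completion of `E ⊗ F` in the projective norm. -/
abbrev ProjTensor : Type _ := UniformSpace.Completion (ProjAlg E F)

variable {Z : Type*} [NormedAddCommGroup Z] [NormedSpace ℂ Z]

theorem norm_lift_le (B : E →L[ℂ] F →L[ℂ] Z) (u : E ⊗[ℂ] F) :
    ‖TensorProduct.lift ((ContinuousLinearMap.coeLM ℂ).comp B.toLinearMap) u‖ ≤
      ‖B‖ * projNorm u := by
  unfold projNorm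
  rw [Real.mul_iInf_of_nonneg (r := ‖B‖) (norm_nonneg B)]
  refine le_ciInf fun p => ?_
  obtain ⟨l, hl⟩ := p
  change _ ≤ ‖B‖ * repCost l
  rw [mem_reps] at hl
  subst hl
  induction l with
  | nil => simp [repCost]
  | cons q l ih =>
    simp only [List.map_cons, List.sum_cons, map_add, repCost, mul_add] at ih ⊢
    refine (norm_add_le _ _).trans (add_le_add ?_ ih)
    rw [← mul_assoc]
    exact B.le_opNorm₂ _ _

/-- The bounded linear map on the algebraic tensor product defined by a bounded bilinear map `B`. -/
def algLift (B : E →L[ℂ] F →L[ℂ] Z) : ProjAlg E F →L[ℂ] Z :=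
  LinearMap.mkContinuous
    ((TensorProduct.lift ((ContinuousLinearMap.coeLM ℂ).comp B.toLinearMap)).comp
      (toProjAlg E F).symm.toLinearMap)
    ‖B‖ (fun u => norm_lift_le B ((toProjAlg E F).symm u))

theorem algLift_tmul (B : E →L[ℂ] F →L[ℂ] Z) (x : E) (y : F) :
    algLift B (toProjAlg E F (x ⊗ₜ y)) = B x y :=
  TensorProduct.lift.tmul x y

/-- The bounded linear map `E ⊗̂ F → Z` induced by a bounded bilinear map `B : E × F → Z`,
determined by `x ⊗ y ↦ B x y`. -/
def projLift [CompleteSpace Z] (B : E →L[ℂ] F →L[ℂ] Z) : ProjTensor E F →L[ℂ] Z :=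
  (algLift B).extend UniformSpace.Completion.toComplL

theorem projLift_coe [CompleteSpace Z] (B : E →L[ℂ] F →L[ℂ] Z) (u : ProjAlg E F) :
    projLift B (u : ProjTensor E F) = algLift B u :=
  (algLift B).extend_eq (e := UniformSpace.Completion.toComplL (𝕜 := ℂ) (E := ProjAlg E F))
    UniformSpace.Completion.denseRange_coe
    (UniformSpace.Completion.isUniformInducing_coe _) u

/-- The elementary tensor `x ⊗ y`. -/
def ptmul (x : E) (y : F) : ProjTensor E F := ↑(toProjAlg E F (x ⊗ₜ[ℂ] y))

theorem norm_ptmul_le (x : E) (y : F) : ‖ptmul x y‖ ≤ ‖x‖ * ‖y‖ := by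
  unfold ptmul
  rw [UniformSpace.Completion.norm_coe, norm_toProjAlg]
  exact (projNorm_le_repCost [(x, y)] _ (by simp [Reps])).trans_eq (by simp [repCost])

variable (E F) in
/-- The elementary tensor as a bounded bilinear map. -/
def ptmulL : E →L[ℂ] F →L[ℂ] ProjTensor E F :=
  LinearMap.mkContinuous₂
    (LinearMap.mk₂ ℂ (fun (x : E) (y : F) => ptmul x y)
      (fun x x' y => by
        simp only [ptmul, TensorProduct.add_tmul, map_add, UniformSpace.Completion.coe_add])
      (fun c x y => by
        simp only [ptmul, ← TensorProduct.smul_tmul', map_smul, UniformSpace.Completion.coe_smul])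
      (fun x y y' => by
        simp only [ptmul, TensorProduct.tmul_add, map_add, UniformSpace.Completion.coe_add])
      (fun c x y => by
        simp only [ptmul, TensorProduct.tmul_smul, map_smul, UniformSpace.Completion.coe_smul])) 1
    (fun x y => by
      rw [one_mul]
      exact norm_ptmul_le x y)

@[simp]
theorem ptmulL_apply (x : E) (y : F) : ptmulL E F x y = ptmul x y := rfl

@[simp]
theorem projLift_ptmul [CompleteSpace Z] (B : E →L[ℂ] F →L[ℂ] Z) (x : E) (y : F) :
    projLift B (ptmul x y) = B x y :=
  (projLift_coe B _).trans (algLift_tmul B x y)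

theorem projTensor_ext {S T : ProjTensor E F →L[ℂ] Z}
    (h : ∀ x y, S (ptmul x y) = T (ptmul x y)) : S = T := by
  ext u
  refine UniformSpace.Completion.induction_on u (isClosed_eq S.continuous T.continuous) ?_
  intro u
  have : ((S.comp UniformSpace.Completion.toComplL).toLinearMap.comp
        (toProjAlg E F).toLinearMap) =
      (T.comp UniformSpace.Completion.toComplL).toLinearMap.comp
        (toProjAlg E F).toLinearMap :=
    TensorProduct.ext' fun x y => h x y
  exact LinearMap.congr_fun this ((toProjAlg E F).symm u)

theorem norm_projLift_le [CompleteSpace Z] (B : E →L[ℂ] F →L[ℂ] Z) : ‖projLift B‖ ≤ ‖B‖ := by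
  refine ContinuousLinearMap.opNorm_le_bound (projLift B) (norm_nonneg B) fun u => ?_
  refine UniformSpace.Completion.induction_on u
    (isClosed_le (by fun_prop) (by fun_prop)) fun u => ?_
  rw [UniformSpace.Completion.norm_coe, projLift_coe]
  exact norm_lift_le B ((toProjAlg E F).symm u)

variable {E₁ E₂ F₁ F₂ : Type*}
  [NormedAddCommGroup E₁] [NormedSpace ℂ E₁] [NormedAddCommGroup E₂] [NormedSpace ℂ E₂]
  [NormedAddCommGroup F₁] [NormedSpace ℂ F₁] [NormedAddCommGroup F₂] [NormedSpace ℂ F₂]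

variable (E₂ F₂ E F) in
/-- The bounded bilinear map sending two bounded operators `S`, `T` to `S ⊗ T`. -/
def projMapL : (E₂ →L[ℂ] E) →L[ℂ] (F₂ →L[ℂ] F) →L[ℂ] (ProjTensor E₂ F₂ →L[ℂ] ProjTensor E F) :=
  LinearMap.mkContinuous₂
    (LinearMap.mk₂ ℂ (fun S T => projLift ((ptmulL E F).bilinearComp S T))
      (fun S S' T => projTensor_ext fun x y => by
        simp [-ptmulL_apply])
      (fun c S T => projTensor_ext fun x y => by
        simp [-ptmulL_apply])
      (fun S T T' => projTensor_ext fun x y => by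
        simp [-ptmulL_apply])
      (fun c S T => projTensor_ext fun x y => by
        simp [-ptmulL_apply])) 1
    (fun S T => by
      rw [one_mul]
      refine (norm_projLift_le _).trans ?_
      refine ContinuousLinearMap.opNorm_le_bound₂ _ (by positivity) fun x y => ?_
      refine (norm_ptmul_le (S x) (T y)).trans ?_
      calc ‖S x‖ * ‖T y‖ ≤ (‖S‖ * ‖x‖) * (‖T‖ * ‖y‖) := by
            gcongr
            · exact S.le_opNorm x
            · exact T.le_opNorm y
        _ = _ := by ring)

/-- The bounded bilinear map `(E₁ ⊗̂ F₁) × (E₂ ⊗̂ F₂) → E ⊗̂ F` determined by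
`(x₁ ⊗ y₁, x₂ ⊗ y₂) ↦ c(x₁, x₂) ⊗ d(y₁, y₂)`. -/
def projMul (c : E₁ →L[ℂ] E₂ →L[ℂ] E) (d : F₁ →L[ℂ] F₂ →L[ℂ] F) :
    ProjTensor E₁ F₁ →L[ℂ] ProjTensor E₂ F₂ →L[ℂ] ProjTensor E F :=
  projLift ((projMapL E F E₂ F₂).bilinearComp c d)

theorem projMul_ptmul (c : E₁ →L[ℂ] E₂ →L[ℂ] E) (d : F₁ →L[ℂ] F₂ →L[ℂ] F)
    (x₁ : E₁) (y₁ : F₁) (x₂ : E₂) (y₂ : F₂) :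
    projMul c d (ptmul x₁ y₁) (ptmul x₂ y₂) = ptmul (c x₁ x₂) (d y₁ y₂) := by
  unfold projMul
  rw [projLift_ptmul]
  exact projLift_ptmul _ _ _

end ProjectiveTensorProduct

section Extension

/-! Extension by continuity of a bounded bilinear map defined on dense subspaces. -/

variable {D₁ D₂ V₁ V₂ W : Type*} [AddCommGroup D₁] [Module ℂ D₁] [AddCommGroup D₂] [Module ℂ D₂]
  [NormedAddCommGroup V₁] [NormedSpace ℂ V₁] [NormedAddCommGroup V₂] [NormedSpace ℂ V₂]
  [NormedAddCommGroup W] [NormedSpace ℂ W] [CompleteSpace W]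
  {e₁ : D₁ →ₗ[ℂ] V₁} {e₂ : D₂ →ₗ[ℂ] V₂} (b : D₁ →ₗ[ℂ] D₂ →ₗ[ℂ] W)
  (h₂ : DenseRange e₂)
  (hb : ∃ C, 0 ≤ C ∧ ∀ x y, ‖b x y‖ ≤ C * ‖e₁ x‖ * ‖e₂ y‖)

/-- The extension in the second variable. -/
def extendRight : D₁ →ₗ[ℂ] (V₂ →L[ℂ] W) where
  toFun x := (b x).extendOfNorm e₂
  map_add' x x' := by
    obtain ⟨C, -, hC⟩ := hb
    refine ContinuousLinearMap.coeFn_injective (h₂.equalizer (ContinuousLinearMap.continuous _)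
      (ContinuousLinearMap.continuous _) (funext fun y => ?_))
    have h (z : D₁) : (b z).extendOfNorm e₂ (e₂ y) = b z y :=
      LinearMap.extendOfNorm_eq h₂ ⟨_, hC z⟩ y
    exact (h _).trans (by simp [← h])
  map_smul' c x := by
    obtain ⟨C, -, hC⟩ := hb
    refine ContinuousLinearMap.coeFn_injective (h₂.equalizer (ContinuousLinearMap.continuous _)
      (ContinuousLinearMap.continuous _) (funext fun y => ?_))
    have h (z : D₁) : (b z).extendOfNorm e₂ (e₂ y) = b z y :=
      LinearMap.extendOfNorm_eq h₂ ⟨_, hC z⟩ y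
    exact (h _).trans (by simp [← h])

theorem extendRight_apply (x : D₁) (y : D₂) : extendRight b h₂ hb x (e₂ y) = b x y :=
  hb.elim fun _ hC => LinearMap.extendOfNorm_eq h₂ ⟨_, hC.2 x⟩ y

theorem exists_norm_extendRight_le : ∃ C, ∀ x, ‖extendRight b h₂ hb x‖ ≤ C * ‖e₁ x‖ := by
  obtain ⟨C, h0, hC⟩ := id hb
  exact ⟨C, fun x => LinearMap.opNorm_extendOfNorm_le h₂ (by positivity) (hC x)⟩

/-- The unique bounded bilinear map on `V₁ × V₂` extending `b` along the maps `e₁`, `e₂` with dense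
range. -/
def extend₂ : V₁ →L[ℂ] V₂ →L[ℂ] W := (extendRight b h₂ hb).extendOfNorm e₁

theorem extend₂_apply (h₁ : DenseRange e₁) (x : D₁) (y : D₂) : extend₂ (e₁ := e₁) b h₂ hb (e₁ x) (e₂ y) = b x y := by
  unfold extend₂
  rw [LinearMap.extendOfNorm_eq h₁ (exists_norm_extendRight_le b h₂ hb)]
  exact extendRight_apply b h₂ hb x y

end Extension

section WeightedL1

variable {G : Type*} [Group G] [TopologicalSpace G]

variable (G) in
/-- A weight on a topological group: a continuous, strictly positive, submultiplicative function
with value `1` at the identity. -/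
structure Weight where
  /-- the underlying function -/
  toFun : G → ℝ
  continuous' : Continuous toFun
  pos' : ∀ t, 0 < toFun t
  submul' : ∀ s t, toFun (s * t) ≤ toFun s * toFun t
  one' : toFun 1 = 1

instance : CoeFun (Weight G) (fun _ => G → ℝ) := ⟨Weight.toFun⟩

variable [MeasurableSpace G]

/-- The measure `ω λ`, `E ↦ ∫_E ω dλ`. -/
def weightedMeasure (ω : Weight G) (μ : Measure G) : Measure G :=
  μ.withDensity fun t => ENNReal.ofReal (ω t)

/-- The weighted Bochner space `L¹_ω(G, X)`, with norm `∫ ‖f(t)‖ ω(t) dt`. -/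
abbrev L1W (ω : Weight G) (μ : Measure G) (X : Type*) [NormedAddCommGroup X] : Type _ :=
  Lp X 1 (weightedMeasure ω μ)

variable [IsTopologicalGroup G] [LocallyCompactSpace G] [BorelSpace G]
  (ω : Weight G) (μ : Measure G) {X : Type*} [NormedAddCommGroup X] [NormedSpace ℂ X]

theorem measurable_ofReal_weight : Measurable fun t => ENNReal.ofReal (ω t) :=
  ENNReal.measurable_ofReal.comp ω.continuous'.measurable

variable {ω μ} in
theorem integrable_weightedMeasure_iff {f : G → X} :
    Integrable f (weightedMeasure ω μ) ↔ Integrable (fun t => ω t • f t) μ := by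
  unfold weightedMeasure
  rw [integrable_withDensity_iff_integrable_smul'
    (measurable_ofReal_weight ω) (by simp)]
  simp only [ENNReal.toReal_ofReal (ω.pos' _).le]

theorem integral_weightedMeasure (f : G → ℝ) :
    ∫ t, f t ∂(weightedMeasure ω μ) = ∫ t, ω t * f t ∂μ := by
  unfold weightedMeasure
  rw [integral_withDensity_eq_integral_toReal_smul
    (measurable_ofReal_weight ω) (by simp)]
  simp only [ENNReal.toReal_ofReal (ω.pos' _).le, smul_eq_mul]

variable [μ.IsHaarMeasure]

theorem memLp_of_cc (f : C_c(G, X)) : MemLp f 1 (weightedMeasure ω μ) := by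
  rw [memLp_one_iff_integrable, integrable_weightedMeasure_iff]
  exact (ω.continuous'.smul f.continuous).integrable_of_hasCompactSupport
    f.hasCompactSupport.smul_left

/-- The canonical map `C₀₀(G, X) → L¹_ω(G, X)`. -/
def ccToL1 : C_c(G, X) →ₗ[ℂ] L1W ω μ X where
  toFun f := (memLp_of_cc ω μ f).toLp f
  map_add' _ _ := rfl
  map_smul' _ _ := rfl

theorem norm_ccToL1 (f : C_c(G, X)) : ‖ccToL1 ω μ f‖ = ∫ t, ω t * ‖f t‖ ∂μ := by
  rw [← integral_weightedMeasure, L1.norm_eq_integral_norm]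
  exact integral_congr_ae ((memLp_of_cc ω μ f).coeFn_toLp.mono fun t ht => congrArg norm ht)

/-- Density of continuous functions with compact support in `L¹` for a regular measure on a locally
compact group. -/
theorem exists_cc_approx [μ.Regular] {f : G → X} (hf : MemLp f 1 μ) {ε : ENNReal} (hε : ε ≠ 0) :
    ∃ g : G → X, eLpNorm (f - g) 1 μ ≤ ε ∧ Continuous g ∧ HasCompactSupport g := by
  refine hf.induction_dense ENNReal.one_ne_top _ ?_ ?_ ?_ hε
  · intro c t ht htμ ε hε
    obtain ⟨δ, δpos, hδ⟩ := exists_Lp_half X μ 1 hε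
    obtain ⟨η, ηpos, hη⟩ := exists_eLpNorm_indicator_le (μ := μ) ENNReal.one_ne_top c δpos.ne'
    have hη_pos' : (0 : ENNReal) < η := ENNReal.coe_pos.2 ηpos
    obtain ⟨s, st, s_compact, s_closed, μs⟩ :=
      ht.exists_isCompact_isClosed_sdiff_lt htμ.ne hη_pos'.ne'
    have hsμ : μ s < ⊤ := (measure_mono st).trans_lt htμ
    have I1 : eLpNorm ((s.indicator fun _ => c) - t.indicator fun _ => c) 1 μ ≤ δ := by
      rw [← eLpNorm_neg, neg_sub, ← Set.indicator_sdiff st]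
      exact hη _ μs.le
    obtain ⟨V, sV, V_open, -, hV⟩ := s_closed.measurableSet.exists_isOpen_sdiff_lt hsμ.ne hη_pos'.ne'
    obtain ⟨g, g1, g0, gc, g01⟩ := exists_continuous_one_zero_of_isCompact s_compact
      V_open.isClosed_compl (Set.disjoint_compl_right_iff_subset.2 sV)
    have gcont : Continuous fun x => g x • c := by fun_prop
    have I2 : eLpNorm ((fun x => g x • c) - s.indicator fun _ => c) 1 μ ≤ δ := by
      refine (eLpNorm_mono fun x => ?_).trans (hη (V \ s) hV.le)
      by_cases hx : x ∈ s
      · simp [hx, g1 hx]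
      · by_cases hxV : x ∈ V
        · simp only [Pi.sub_apply, hx, hxV, not_false_eq_true, Set.indicator_of_notMem, sub_zero,
            Set.mem_sdiff, and_self, Set.indicator_of_mem, norm_smul]
          refine mul_le_of_le_one_left (norm_nonneg _) ?_
          rw [Real.norm_eq_abs, abs_of_nonneg (g01 x).1]
          exact (g01 x).2
        · simp [hx, hxV, g0 hxV]
    refine ⟨fun x => g x • c, ?_, gcont, gc.smul_right⟩
    have := (hδ _ _ ((gcont.integrable_of_hasCompactSupport gc.smul_right).aestronglyMeasurable.sub
        (aestronglyMeasurable_const.indicator s_closed.measurableSet))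
      ((aestronglyMeasurable_const.indicator s_closed.measurableSet).sub
        (aestronglyMeasurable_const.indicator ht)) I2 I1).le
    rwa [sub_add_sub_cancel] at this
  · rintro f g ⟨f_cont, hf⟩ ⟨g_cont, hg⟩
    exact ⟨f_cont.add g_cont, hf.add hg⟩
  · rintro f ⟨f_cont, hf⟩
    exact (f_cont.integrable_of_hasCompactSupport hf).aestronglyMeasurable

theorem denseRange_ccToL1 [μ.Regular] :
    DenseRange (ccToL1 ω μ : C_c(G, X) →ₗ[ℂ] L1W ω μ X) := by
  intro u
  refine Metric.mem_closure_iff.2 fun ε hε => ?_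
  have hu : Integrable (fun t => ω t • u t) μ :=
    integrable_weightedMeasure_iff.1 (L1.integrable_coeFn u)
  obtain ⟨h, hh, hc, hs⟩ := exists_cc_approx μ (memLp_one_iff_integrable.2 hu)
    (ε := ENNReal.ofReal (ε / 2)) (by simpa using hε)
  have hωc : Continuous fun t => (ω t)⁻¹ :=
    ω.continuous'.inv₀ fun t => (ω.pos' t).ne'
  let g : C_c(G, X) := ⟨⟨fun t => (ω t)⁻¹ • h t, hωc.smul hc⟩, hs.smul_left⟩
  refine ⟨ccToL1 ω μ g, ⟨g, rfl⟩, ?_⟩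
  have hhi : Integrable h μ := hc.integrable_of_hasCompactSupport hs
  have e1 : dist u (ccToL1 ω μ g) = ∫ t, ‖ω t • u t - h t‖ ∂μ := by
    rw [dist_eq_norm, L1.norm_eq_integral_norm]
    have : (fun t => ‖(u - ccToL1 ω μ g) t‖) =ᵐ[weightedMeasure ω μ] fun t => ‖u t - g t‖ := by
      filter_upwards [Lp.coeFn_sub u (ccToL1 ω μ g), (memLp_of_cc ω μ g).coeFn_toLp] with t h1 h2
      rw [h1, Pi.sub_apply]
      exact congrArg (fun z => ‖u t - z‖) h2
    rw [integral_congr_ae this, integral_weightedMeasure]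
    refine integral_congr_ae (Filter.Eventually.of_forall fun t => ?_)
    have hg : g t = (ω t)⁻¹ • h t := rfl
    have hp := ω.pos' t
    have : ω t • u t - h t = ω t • (u t - g t) := by
      rw [hg, smul_sub, smul_inv_smul₀ hp.ne']
    simp only [this, norm_smul, Real.norm_eq_abs, abs_of_pos hp]
  rw [e1]
  have e2 : ENNReal.ofReal (∫ t, ‖ω t • u t - h t‖ ∂μ) ≤ ENNReal.ofReal (ε / 2) := by
    rw [eLpNorm_one_eq_lintegral_enorm,
      ← ofReal_integral_norm_eq_lintegral_enorm (hu.sub hhi)] at hh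
    exact hh
  have := (ENNReal.ofReal_le_ofReal_iff (by positivity)).1 e2
  linarith

end WeightedL1

section Convolution

variable {G : Type*} [Group G] [TopologicalSpace G] [MeasurableSpace G]
  [IsTopologicalGroup G] [LocallyCompactSpace G] [BorelSpace G]
  (ω : Weight G) (μ : Measure G) [μ.IsHaarMeasure]
  {E F Z : Type*} [NormedAddCommGroup E] [NormedSpace ℂ E]
  [NormedAddCommGroup F] [NormedSpace ℂ F] [NormedAddCommGroup Z] [NormedSpace ℂ Z]

/-- The convolution `s ↦ ∫ B(f(t), g(t⁻¹s)) dt` of two continuous functions with compact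
support. -/
def ccConv (B : E →L[ℂ] F →L[ℂ] Z) (f : C_c(G, E)) (g : C_c(G, F)) : C_c(G, Z) where
  toFun s := ∫ t, B (f t) (g (t⁻¹ * s)) ∂μ
  continuous_toFun := by
    rw [← continuousOn_univ]
    refine continuousOn_integral_of_compact_support (k := tsupport f) f.hasCompactSupport ?_ ?_
    · refine Continuous.continuousOn ?_
      have := f.continuous
      have := g.continuous
      simp only [Function.uncurry_def]
      fun_prop
    · intro s t _ ht
      simp [image_eq_zero_of_notMem_tsupport ht]
  hasCompactSupport' := by
    refine HasCompactSupport.intro (f.hasCompactSupport.mul g.hasCompactSupport) fun s hs => ?_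
    refine integral_eq_zero_of_ae (Filter.Eventually.of_forall fun t => ?_)
    by_contra h
    refine hs ⟨t, ?_, t⁻¹ * s, ?_, by simp⟩
    · by_contra ht
      exact h (by simp [image_eq_zero_of_notMem_tsupport ht])
    · by_contra ht
      exact h (by simp [image_eq_zero_of_notMem_tsupport ht])

theorem ccConv_apply (B : E →L[ℂ] F →L[ℂ] Z) (f : C_c(G, E)) (g : C_c(G, F)) (s : G) :
    ccConv μ B f g s = ∫ t, B (f t) (g (t⁻¹ * s)) ∂μ := rfl

theorem ccConv_integrable (B : E →L[ℂ] F →L[ℂ] Z) (f : C_c(G, E)) (g : C_c(G, F)) (s : G) :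
    Integrable (fun t => B (f t) (g (t⁻¹ * s))) μ := by
  have := f.continuous
  have := g.continuous
  refine Continuous.integrable_of_hasCompactSupport (by fun_prop) ?_
  refine f.hasCompactSupport.mono fun t ht => ?_
  contrapose! ht
  simp [Function.notMem_support.1 ht]

/-- The convolution of continuous functions with compact support as a bilinear map. -/
def ccConvₗ (B : E →L[ℂ] F →L[ℂ] Z) : C_c(G, E) →ₗ[ℂ] C_c(G, F) →ₗ[ℂ] C_c(G, Z) :=
  LinearMap.mk₂ ℂ (ccConv μ B)
    (fun f f' g => by
      ext s
      simp only [ccConv_apply, Pi.add_apply, CompactlySupportedContinuousMap.coe_add, map_add,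
        add_apply]
      exact integral_add (ccConv_integrable μ B f g s) (ccConv_integrable μ B f' g s))
    (fun c f g => by
      ext s
      simp only [ccConv_apply, Pi.smul_apply, CompactlySupportedContinuousMap.coe_smul, map_smul,
        smul_apply]
      exact integral_smul _ _)
    (fun f g g' => by
      ext s
      simp only [ccConv_apply, Pi.add_apply, CompactlySupportedContinuousMap.coe_add, map_add]
      exact integral_add (ccConv_integrable μ B f g s) (ccConv_integrable μ B f g' s))
    (fun c f g => by
      ext s
      simp only [ccConv_apply, Pi.smul_apply, CompactlySupportedContinuousMap.coe_smul, map_smul]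
      exact integral_smul _ _)

theorem norm_ccConv_le (B : E →L[ℂ] F →L[ℂ] Z) (f : C_c(G, E)) (g : C_c(G, F)) :
    ‖ccToL1 ω μ (ccConv μ B f g)‖ ≤ ‖B‖ * ‖ccToL1 ω μ f‖ * ‖ccToL1 ω μ g‖ := by
  have hf := f.continuous
  have hg := g.continuous
  have hω := ω.continuous'
  have hfi : Integrable (fun t => ω t * ‖f t‖) μ :=
    (hω.mul hf.norm).integrable_of_hasCompactSupport f.hasCompactSupport.norm.mul_left
  have hgi : Integrable (fun t => ω t * ‖g t‖) μ :=
    (hω.mul hg.norm).integrable_of_hasCompactSupport g.hasCompactSupport.norm.mul_left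
  simp only [norm_ccToL1]
  let H : G → G → ℝ := fun s t => ω s * (‖f t‖ * ‖g (t⁻¹ * s)‖)
  have hHc : Continuous H.uncurry := by
    simp only [H, Function.uncurry_def]
    fun_prop
  have hHs : HasCompactSupport H.uncurry := by
    refine HasCompactSupport.intro
      ((f.hasCompactSupport.mul g.hasCompactSupport).prod f.hasCompactSupport) fun p hp => ?_
    by_contra h
    refine hp ?_
    have h1 : p.2 ∈ tsupport f := by
      by_contra ht
      exact h (by simp [H, Function.uncurry_def, image_eq_zero_of_notMem_tsupport ht])
    have h2 : p.2⁻¹ * p.1 ∈ tsupport g := by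
      by_contra ht
      exact h (by simp [H, Function.uncurry_def, image_eq_zero_of_notMem_tsupport ht])
    exact ⟨⟨p.2, h1, _, h2, by simp⟩, h1⟩
  have hgt (t : G) : Integrable (fun s => ω s * ‖g (t⁻¹ * s)‖) μ := by
    refine Continuous.integrable_of_hasCompactSupport (by fun_prop) ?_
    refine HasCompactSupport.mul_left ?_
    exact (g.hasCompactSupport.comp_homeomorph (Homeomorph.mulLeft t⁻¹)).norm
  have key (t : G) : ∫ s, ω s * ‖g (t⁻¹ * s)‖ ∂μ ≤ ω t * ∫ s, ω s * ‖g s‖ ∂μ := by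
    rw [← integral_mul_left_eq_self _ t, ← integral_const_mul]
    refine integral_mono ((hgt t).comp_mul_left t) (hgi.const_mul _) fun s => ?_
    simp only [inv_mul_cancel_left]
    rw [← mul_assoc]
    exact mul_le_mul_of_nonneg_right (ω.submul' t s) (norm_nonneg _)
  calc ∫ s, ω s * ‖ccConv μ B f g s‖ ∂μ
      ≤ ∫ s, ‖B‖ * ∫ t, H s t ∂μ ∂μ := by
        refine integral_mono_of_nonneg (Filter.Eventually.of_forall fun s =>
          mul_nonneg (ω.pos' s).le (norm_nonneg _)) ?_ (Filter.Eventually.of_forall fun s => ?_)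
        · refine Integrable.const_mul ?_ _
          refine Continuous.integrable_of_hasCompactSupport ?_ ?_
          · rw [← continuousOn_univ]
            refine continuousOn_integral_of_compact_support (k := tsupport f) f.hasCompactSupport
              hHc.continuousOn ?_
            intro s t _ ht
            simp [H, image_eq_zero_of_notMem_tsupport ht]
          · refine HasCompactSupport.intro (f.hasCompactSupport.mul g.hasCompactSupport)
              fun s hs => ?_
            refine integral_eq_zero_of_ae (Filter.Eventually.of_forall fun t => ?_)
            by_contra h
            refine hs ⟨t, ?_, t⁻¹ * s, ?_, by simp⟩
            · by_contra ht
              exact h (by simp [H, image_eq_zero_of_notMem_tsupport ht])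
            · by_contra ht
              exact h (by simp [H, image_eq_zero_of_notMem_tsupport ht])
        · simp only [H]
          rw [integral_const_mul, ← mul_assoc, mul_comm ‖B‖, mul_assoc]
          refine mul_le_mul_of_nonneg_left ?_ (ω.pos' s).le
          rw [← integral_const_mul, ccConv_apply]
          refine norm_integral_le_of_norm_le ?_ (Filter.Eventually.of_forall fun t => ?_)
          · refine Integrable.const_mul ?_ _
            refine Continuous.integrable_of_hasCompactSupport (by fun_prop) ?_
            exact f.hasCompactSupport.norm.mul_right
          · rw [← mul_assoc]
            exact B.le_opNorm₂ _ _
    _ = ‖B‖ * ∫ t, ∫ s, H s t ∂μ ∂μ := by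
        rw [integral_const_mul, integral_integral_swap_of_hasCompactSupport hHc hHs]
    _ ≤ ‖B‖ * ∫ t, (ω t * ‖f t‖) * ∫ s, ω s * ‖g s‖ ∂μ ∂μ := by
        refine mul_le_mul_of_nonneg_left ?_ (norm_nonneg B)
        refine integral_mono_of_nonneg (Filter.Eventually.of_forall fun t =>
          integral_nonneg fun s => mul_nonneg (ω.pos' s).le (by positivity)) (hfi.mul_const _)
          (Filter.Eventually.of_forall fun t => ?_)
        have : ∀ s, H s t = ‖f t‖ * (ω s * ‖g (t⁻¹ * s)‖) := fun s => by simp only [H]; ring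
        simp only [this]
        rw [integral_const_mul, mul_comm (ω t), mul_assoc]
        exact mul_le_mul_of_nonneg_left (key t) (norm_nonneg _)
    _ = _ := by rw [integral_mul_const, mul_assoc]

variable [μ.Regular] [CompleteSpace Z]

/-- The vector-valued convolution `L¹_ω(G, E) × L¹_ω(G, F) → L¹_ω(G, Z)` associated with a bounded
bilinear map `B : E × F → Z`: the bounded bilinear extension of
`(f * g)(s) = ∫ B(f(t), g(t⁻¹s)) dt` for `f`, `g` continuous with compact support. -/
def conv (B : E →L[ℂ] F →L[ℂ] Z) : L1W ω μ E →L[ℂ] L1W ω μ F →L[ℂ] L1W ω μ Z :=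
  extend₂ ((ccConvₗ μ B).compr₂ (ccToL1 ω μ)) (e₁ := ccToL1 ω μ) (denseRange_ccToL1 ω μ)
    ⟨‖B‖, norm_nonneg B, norm_ccConv_le ω μ B⟩

theorem conv_cc (B : E →L[ℂ] F →L[ℂ] Z) (f : C_c(G, E)) (g : C_c(G, F)) :
    conv ω μ B (ccToL1 ω μ f) (ccToL1 ω μ g) = ccToL1 ω μ (ccConv μ B f g) :=
  extend₂_apply ((ccConvₗ μ B).compr₂ (ccToL1 ω μ)) (denseRange_ccToL1 ω μ)
    ⟨‖B‖, norm_nonneg B, norm_ccConv_le ω μ B⟩ (denseRange_ccToL1 ω μ) f g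

end Convolution

section Main

variable {G : Type*} [Group G] [TopologicalSpace G] [MeasurableSpace G]
  (ω : Weight G) (μ : Measure G)
  (X : Type*) [NormedAddCommGroup X] [NormedSpace ℂ X]

/-- The canonical map `α_X : L¹_ω(G) ⊗̂ X → L¹_ω(G, X)`, determined by
`α_X(f ⊗ x)(t) = f(t) x`. -/
def alpha [CompleteSpace X] : ProjTensor (L1W ω μ ℂ) X →L[ℂ] L1W ω μ X :=
  projLift (ContinuousLinearMap.compLpL₂ 1 (weightedMeasure ω μ)
    (ContinuousLinearMap.lsmul ℂ ℂ : ℂ →L[ℂ] X →L[ℂ] X).flip).flip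

theorem alpha_ptmul [CompleteSpace X] (f : L1W ω μ ℂ) (x : X) :
    alpha ω μ X (ptmul f x) =ᵐ[weightedMeasure ω μ] fun t => f t • x := by
  unfold alpha
  rw [projLift_ptmul]
  exact ContinuousLinearMap.coeFn_compLp'
    ((ContinuousLinearMap.lsmul ℂ ℂ : ℂ →L[ℂ] X →L[ℂ] X).flip x) f

/-- A bounded bilinear multiplication `m` makes the (complete) space `V` a Banach algebra. -/
structure IsBanachAlgebraMul {V : Type*} [NormedAddCommGroup V] [NormedSpace ℂ V]
    (m : V →L[ℂ] V →L[ℂ] V) : Prop where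
  assoc : ∀ u v w, m (m u v) w = m u (m v w)
  norm_le : ∀ u v, ‖m u v‖ ≤ ‖u‖ * ‖v‖

/-- The bounded bilinear map `ρ` makes the (complete) space `W` a Banach left module over the
Banach algebra `V` with multiplication `m`, with module constant at most `C`. -/
structure IsBanachLeftModule {V W : Type*} [NormedAddCommGroup V] [NormedSpace ℂ V]
    [NormedAddCommGroup W] [NormedSpace ℂ W]
    (m : V →L[ℂ] V →L[ℂ] V) (ρ : V →L[ℂ] W →L[ℂ] W) (C : ℝ) : Prop where
  assoc : ∀ u v w, ρ (m u v) w = ρ u (ρ v w)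
  norm_le : ∀ u w, ‖ρ u w‖ ≤ C * ‖u‖ * ‖w‖

/-- The product `(L¹_ω(G) ⊗̂ A) × (L¹_ω(G) ⊗̂ X) → L¹_ω(G) ⊗̂ X` associated with a bounded bilinear
map `ρ : A × X → X`, determined by `(f ⊗ a)(g ⊗ x) = (f * g) ⊗ ρ(a, x)`. -/
def tensorMul [IsTopologicalGroup G] [LocallyCompactSpace G] [BorelSpace G] [μ.IsHaarMeasure]
    [μ.Regular] {A X : Type*} [NormedAddCommGroup A] [NormedSpace ℂ A]
    [NormedAddCommGroup X] [NormedSpace ℂ X] (ρ : A →L[ℂ] X →L[ℂ] X) :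
    ProjTensor (L1W ω μ ℂ) A →L[ℂ] ProjTensor (L1W ω μ ℂ) X →L[ℂ] ProjTensor (L1W ω μ ℂ) X :=
  projMul (conv ω μ (ContinuousLinearMap.mul ℂ ℂ)) ρ

end Main

end Beurling

end

/-!
Two facts carry the theorem.

*The Bochner space `L¹(ν, Y)` is the projective tensor product of `L¹(ν)` and `Y`.* A bounded
bilinear map `B : L¹(ν) × Y → V` gives the finitely additive operator-valued set function
`s ↦ B(1_s, ·)`, which satisfies `‖B(1_s, ·)‖ ≤ ‖B‖ ν(s)` and therefore extends to an operator
`l1Lift B : L¹(ν, Y) → V` of norm at most `‖B‖` with `l1Lift B (f y) = B(f, y)`. Applied to the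
canonical bilinear map into `L¹_ω(G) ⊗̂ Y`, this gives a contractive two-sided inverse of the
contraction `α_Y`, so that `α_Y` is an isometry onto `L¹_ω(G, Y)` (`isometry_alpha`,
`surjective_alpha`).

*Both products are determined on dense subspaces.* The convolution of continuous compactly supported
functions is associative by Fubini's theorem and left invariance, whenever the bilinear maps of the
coefficients are (`ccConv_assoc`), and contractive up to the norm of the bilinear map; both
properties pass to `L¹_ω` by density (`conv_assoc`, `norm_conv_apply_le`). On the tensor products,
associativity and multiplicativity of `α` are checked on elementary tensors (`projMul_assoc`,
`alpha_projMul`), the latter because `(f y) * (g z) = (f * g) D(y, z)`.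

The lemmas are stated for arbitrary bounded bilinear maps of the coefficients, so that the algebra
`A` and the module `X` are instances of the same statements.
-/

namespace Beurling

/-! ### The universal property of the Bochner space `L¹(ν, Y)` -/

section UniversalProperty

variable {α : Type*} [MeasurableSpace α] {ν : Measure α}
  {Y V : Type*} [NormedAddCommGroup Y] [NormedSpace ℂ Y] [NormedAddCommGroup V] [NormedSpace ℂ V]

/-- The bounded bilinear map `L¹(ν) × Y → L¹(ν, Y)`, `(f, y) ↦ f(·) y`. -/
noncomputable def smulConst (ν : Measure α) (Y : Type*) [NormedAddCommGroup Y] [NormedSpace ℂ Y] :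
    Lp ℂ 1 ν →L[ℂ] Y →L[ℂ] Lp Y 1 ν :=
  (ContinuousLinearMap.compLpL₂ 1 ν
    (ContinuousLinearMap.lsmul ℂ ℂ : ℂ →L[ℂ] Y →L[ℂ] Y).flip).flip

theorem coeFn_smulConst (f : Lp ℂ 1 ν) (y : Y) : smulConst ν Y f y =ᵐ[ν] fun t => f t • y :=
  ContinuousLinearMap.coeFn_compLp' ((ContinuousLinearMap.lsmul ℂ ℂ : ℂ →L[ℂ] Y →L[ℂ] Y).flip y) f

theorem norm_smulConst_le : ‖smulConst ν Y‖ ≤ 1 := by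
  rw [smulConst, ContinuousLinearMap.opNorm_flip]
  refine (ContinuousLinearMap.norm_compLpL₂_le _).trans ?_
  rw [ContinuousLinearMap.opNorm_flip]
  exact ContinuousLinearMap.opNorm_lsmul_le

theorem smulConst_indicatorConstLp {s : Set α} (hs : MeasurableSet s) (hνs : ν s ≠ ⊤)
    (c : ℂ) (y : Y) :
    smulConst ν Y (indicatorConstLp 1 hs hνs c) y = indicatorConstLp 1 hs hνs (c • y) := by
  ext1
  filter_upwards [coeFn_smulConst (indicatorConstLp 1 hs hνs c) y,
    indicatorConstLp_coeFn (p := 1) (hs := hs) (hμs := hνs) (c := c),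
    indicatorConstLp_coeFn (p := 1) (hs := hs) (hμs := hνs) (c := c • y)] with t h₁ h₂ h₃
  rw [h₁, h₂, h₃]
  by_cases ht : t ∈ s <;> simp [ht]

/-- Two bounded operators on `L¹(ν, Y)` agree if they agree on the functions `1_s y` for `s` of
finite measure. -/
theorem l1_ext_indicator {S T : Lp Y 1 ν →L[ℂ] V}
    (h : ∀ (s : Set α) (hs : MeasurableSet s) (hνs : ν s ≠ ⊤) (y : Y),
      S (indicatorConstLp 1 hs hνs y) = T (indicatorConstLp 1 hs hνs y)) : S = T := by
  ext f
  induction f using Lp.induction ENNReal.one_ne_top with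
  | indicatorConst y hs hνs =>
    rw [Lp.simpleFunc.coe_indicatorConst]
    exact h _ hs hνs.ne y
  | add hf hg _ h₁ h₂ => rw [map_add, map_add, h₁, h₂]
  | isClosed => exact isClosed_eq S.continuous T.continuous

open Classical in
/-- The operator-valued set function `s ↦ B(1_s, ·)`, set to zero on the sets that are not
measurable or have infinite measure. -/
noncomputable def indicatorOp (B : Lp ℂ 1 ν →L[ℂ] Y →L[ℂ] V) (s : Set α) : Y →L[ℝ] V :=
  if h : MeasurableSet s ∧ ν s ≠ ⊤ then
    (B (indicatorConstLp 1 h.1 h.2 1)).restrictScalars ℝ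
  else 0

theorem indicatorOp_apply (B : Lp ℂ 1 ν →L[ℂ] Y →L[ℂ] V) {s : Set α} (hs : MeasurableSet s)
    (hνs : ν s ≠ ⊤) (y : Y) : indicatorOp B s y = B (indicatorConstLp 1 hs hνs 1) y := by
  rw [indicatorOp, dif_pos ⟨hs, hνs⟩, ContinuousLinearMap.coe_restrictScalars']

theorem indicatorOp_smul (B : Lp ℂ 1 ν →L[ℂ] Y →L[ℂ] V) (c : ℂ) (s : Set α) (y : Y) :
    indicatorOp B s (c • y) = c • indicatorOp B s y := by
  by_cases h : MeasurableSet s ∧ ν s ≠ ⊤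
  · rw [indicatorOp_apply B h.1 h.2, indicatorOp_apply B h.1 h.2, map_smul]
  · simp [indicatorOp, h]

theorem dominatedFinMeasAdditive_indicatorOp (B : Lp ℂ 1 ν →L[ℂ] Y →L[ℂ] V) :
    DominatedFinMeasAdditive ν (indicatorOp B) ‖B‖ := by
  refine ⟨fun s t hs ht hνs hνt hst => ?_, fun s hs hνs => ?_⟩
  · ext y
    have hνst : ν (s ∪ t) ≠ ⊤ := measure_union_ne_top hνs hνt
    rw [add_apply, indicatorOp_apply B hs hνs,
      indicatorOp_apply B ht hνt, indicatorOp_apply B (hs.union ht) hνst,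
      indicatorConstLp_disjoint_union hs ht hνs hνt hst, map_add, add_apply]
  · refine ContinuousLinearMap.opNorm_le_bound _ (by positivity) fun y => ?_
    rw [indicatorOp_apply B hs hνs.ne]
    refine (B.le_opNorm₂ _ _).trans_eq ?_
    rw [norm_indicatorConstLp one_ne_zero ENNReal.one_ne_top]
    simp

/-- The bounded operator `L¹(ν, Y) → V` induced by a bounded bilinear map `L¹(ν) × Y → V`:
`L¹(ν, Y)` has the universal property of the projective tensor product of `L¹(ν)` and `Y`. -/
noncomputable def l1Lift [CompleteSpace V] (B : Lp ℂ 1 ν →L[ℂ] Y →L[ℂ] V) : Lp Y 1 ν →L[ℂ] V :=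
  L1.setToL1' ℂ (dominatedFinMeasAdditive_indicatorOp B) (indicatorOp_smul B)

theorem norm_l1Lift_apply_le [CompleteSpace V] (B : Lp ℂ 1 ν →L[ℂ] Y →L[ℂ] V) (f : Lp Y 1 ν) :
    ‖l1Lift B f‖ ≤ ‖B‖ * ‖f‖ := by
  rw [l1Lift, ← L1.setToL1_eq_setToL1']
  exact L1.norm_setToL1_le_mul_norm _ (norm_nonneg B) f

theorem l1Lift_indicatorConstLp [CompleteSpace V] (B : Lp ℂ 1 ν →L[ℂ] Y →L[ℂ] V) {s : Set α}
    (hs : MeasurableSet s) (hνs : ν s ≠ ⊤) (y : Y) :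
    l1Lift B (indicatorConstLp 1 hs hνs y) = B (indicatorConstLp 1 hs hνs 1) y := by
  rw [l1Lift, ← L1.setToL1_eq_setToL1', L1.setToL1_indicatorConstLp, indicatorOp_apply]

theorem l1Lift_smulConst [CompleteSpace V] (B : Lp ℂ 1 ν →L[ℂ] Y →L[ℂ] V) (f : Lp ℂ 1 ν) (y : Y) :
    l1Lift B (smulConst ν Y f y) = B f y := by
  have h : (l1Lift B).comp ((smulConst ν Y).flip y) = B.flip y := by
    refine l1_ext_indicator fun s hs hνs c => ?_
    have hc : indicatorConstLp 1 hs hνs c = c • indicatorConstLp 1 hs hνs (1 : ℂ) := by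
      refine Lp.ext ?_
      filter_upwards [indicatorConstLp_coeFn (p := 1) (hs := hs) (hμs := hνs) (c := c),
        indicatorConstLp_coeFn (p := 1) (hs := hs) (hμs := hνs) (c := (1 : ℂ)),
        Lp.coeFn_smul c (indicatorConstLp 1 hs hνs (1 : ℂ))] with t h₁ h₂ h₃
      rw [h₁, h₃, Pi.smul_apply, h₂]
      by_cases ht : t ∈ s <;> simp [ht]
    simp only [ContinuousLinearMap.comp_apply, ContinuousLinearMap.flip_apply]
    rw [smulConst_indicatorConstLp, l1Lift_indicatorConstLp, hc, map_smul, map_smul, smul_apply]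
  exact DFunLike.congr_fun h f

end UniversalProperty

/-! ### The canonical map `α` is an isometric isomorphism -/

section Alpha

variable {G : Type*} [Group G] [TopologicalSpace G] [MeasurableSpace G]
  (ω : Weight G) (μ : Measure G)
  {Y : Type*} [NormedAddCommGroup Y] [NormedSpace ℂ Y]

variable (Y) in
/-- The inverse of `alpha`, given by the universal property of `L¹_ω(G, Y)`. -/
noncomputable def alphaInv : L1W ω μ Y →L[ℂ] ProjTensor (L1W ω μ ℂ) Y :=
  l1Lift (ptmulL (L1W ω μ ℂ) Y)

theorem norm_alphaInv_apply_le (f : L1W ω μ Y) : ‖alphaInv ω μ Y f‖ ≤ ‖f‖ := by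
  refine (norm_l1Lift_apply_le _ f).trans (mul_le_of_le_one_left (norm_nonneg f) ?_)
  exact LinearMap.mkContinuous₂_norm_le _ zero_le_one _

variable [CompleteSpace Y]

theorem alpha_ptmul_eq (f : L1W ω μ ℂ) (y : Y) :
    alpha ω μ Y (ptmul f y) = smulConst (weightedMeasure ω μ) Y f y :=
  projLift_ptmul _ f y

theorem norm_alpha_apply_le (u : ProjTensor (L1W ω μ ℂ) Y) : ‖alpha ω μ Y u‖ ≤ ‖u‖ := by
  refine (ContinuousLinearMap.le_of_opNorm_le _ ?_ u).trans_eq (one_mul _)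
  exact (norm_projLift_le _).trans norm_smulConst_le

theorem alphaInv_alpha (u : ProjTensor (L1W ω μ ℂ) Y) : alphaInv ω μ Y (alpha ω μ Y u) = u := by
  have h : (alphaInv ω μ Y).comp (alpha ω μ Y) = ContinuousLinearMap.id ℂ _ := by
    refine projTensor_ext fun f y => ?_
    rw [ContinuousLinearMap.comp_apply, alpha_ptmul_eq, alphaInv, l1Lift_smulConst]
    rfl
  exact DFunLike.congr_fun h u

theorem alpha_alphaInv (f : L1W ω μ Y) : alpha ω μ Y (alphaInv ω μ Y f) = f := by
  have h : (alpha ω μ Y).comp (alphaInv ω μ Y) = ContinuousLinearMap.id ℂ _ := by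
    refine l1_ext_indicator fun s hs hνs y => ?_
    rw [ContinuousLinearMap.comp_apply, alphaInv, l1Lift_indicatorConstLp, ptmulL_apply,
      alpha_ptmul_eq, smulConst_indicatorConstLp, one_smul]
    rfl
  exact DFunLike.congr_fun h f

theorem isometry_alpha : Isometry (alpha ω μ Y) :=
  AddMonoidHomClass.isometry_of_norm _ fun u =>
    (norm_alpha_apply_le ω μ u).antisymm <| by
      simpa only [alphaInv_alpha] using norm_alphaInv_apply_le ω μ (alpha ω μ Y u)

theorem surjective_alpha : Function.Surjective (alpha ω μ Y) :=
  fun f => ⟨alphaInv ω μ Y f, alpha_alphaInv ω μ f⟩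

end Alpha

/-! ### Products of projective tensor products -/

section ProjMul

variable {E E₁ E₂ E₃ E₁₂ E₂₃ F F₁ F₂ F₃ F₁₂ F₂₃ : Type*}
  [NormedAddCommGroup E] [NormedSpace ℂ E] [NormedAddCommGroup F] [NormedSpace ℂ F]
  [NormedAddCommGroup E₁] [NormedSpace ℂ E₁] [NormedAddCommGroup F₁] [NormedSpace ℂ F₁]
  [NormedAddCommGroup E₂] [NormedSpace ℂ E₂] [NormedAddCommGroup F₂] [NormedSpace ℂ F₂]
  [NormedAddCommGroup E₃] [NormedSpace ℂ E₃] [NormedAddCommGroup F₃] [NormedSpace ℂ F₃]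
  [NormedAddCommGroup E₁₂] [NormedSpace ℂ E₁₂] [NormedAddCommGroup F₁₂] [NormedSpace ℂ F₁₂]
  [NormedAddCommGroup E₂₃] [NormedSpace ℂ E₂₃] [NormedAddCommGroup F₂₃] [NormedSpace ℂ F₂₃]

theorem norm_projMapL_apply₂_le (S : E₂ →L[ℂ] E) (T : F₂ →L[ℂ] F) :
    ‖projMapL E F E₂ F₂ S T‖ ≤ ‖S‖ * ‖T‖ := by
  refine (norm_projLift_le ((ptmulL E F).bilinearComp S T)).trans ?_
  refine ContinuousLinearMap.opNorm_le_bound₂ _ (by positivity) fun x y => ?_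
  refine (norm_ptmul_le (S x) (T y)).trans ?_
  calc ‖S x‖ * ‖T y‖ ≤ (‖S‖ * ‖x‖) * (‖T‖ * ‖y‖) := by
        gcongr
        · exact S.le_opNorm x
        · exact T.le_opNorm y
    _ = _ := by ring

theorem norm_projMul_apply_le (c : E₁ →L[ℂ] E₂ →L[ℂ] E) (d : F₁ →L[ℂ] F₂ →L[ℂ] F)
    (u : ProjTensor E₁ F₁) (v : ProjTensor E₂ F₂) :
    ‖projMul c d u v‖ ≤ ‖c‖ * ‖d‖ * ‖u‖ * ‖v‖ := by
  have h : ‖projMul c d‖ ≤ ‖c‖ * ‖d‖ := by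
    refine (norm_projLift_le _).trans ?_
    refine ContinuousLinearMap.opNorm_le_bound₂ _ (by positivity) fun x y => ?_
    refine (norm_projMapL_apply₂_le (c x) (d y)).trans ?_
    calc ‖c x‖ * ‖d y‖ ≤ (‖c‖ * ‖x‖) * (‖d‖ * ‖y‖) := by
          gcongr
          · exact c.le_opNorm x
          · exact d.le_opNorm y
      _ = _ := by ring
  exact ((projMul c d).le_opNorm₂ u v).trans (by gcongr)

/-- Bounded bilinear maps on projective tensor products are determined by elementary tensors. -/
theorem projTensor_ext₂ {Z : Type*} [NormedAddCommGroup Z] [NormedSpace ℂ Z]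
    {S T : ProjTensor E₁ F₁ →L[ℂ] ProjTensor E₂ F₂ →L[ℂ] Z}
    (h : ∀ x₁ y₁ x₂ y₂, S (ptmul x₁ y₁) (ptmul x₂ y₂) = T (ptmul x₁ y₁) (ptmul x₂ y₂)) : S = T :=
  projTensor_ext fun x₁ y₁ => projTensor_ext fun x₂ y₂ => h x₁ y₁ x₂ y₂

/-- The product of two associative bilinear systems on the factors is associative on the projective
tensor products. -/
theorem projMul_assoc {c : E₁ →L[ℂ] E₂ →L[ℂ] E₁₂} {c' : E₁₂ →L[ℂ] E₃ →L[ℂ] E}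
    {e : E₂ →L[ℂ] E₃ →L[ℂ] E₂₃} {e' : E₁ →L[ℂ] E₂₃ →L[ℂ] E}
    {d : F₁ →L[ℂ] F₂ →L[ℂ] F₁₂} {d' : F₁₂ →L[ℂ] F₃ →L[ℂ] F}
    {k : F₂ →L[ℂ] F₃ →L[ℂ] F₂₃} {k' : F₁ →L[ℂ] F₂₃ →L[ℂ] F}
    (hE : ∀ x y z, c' (c x y) z = e' x (e y z)) (hF : ∀ x y z, d' (d x y) z = k' x (k y z))
    (u : ProjTensor E₁ F₁) (v : ProjTensor E₂ F₂) (w : ProjTensor E₃ F₃) :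
    projMul c' d' (projMul c d u v) w = projMul e' k' u (projMul e k v w) := by
  have h₁ (x₁ y₁ x₂ y₂) : (projMul c' d' (projMul c d (ptmul x₁ y₁) (ptmul x₂ y₂))) =
      (projMul e' k' (ptmul x₁ y₁)).comp (projMul e k (ptmul x₂ y₂)) :=
    projTensor_ext fun x₃ y₃ => by
      simp only [ContinuousLinearMap.comp_apply, projMul_ptmul, hE, hF]
  -- Both sides are curried into trilinear operators, so that they can be compared on elementary
  -- tensors.
  have h₂ : (ContinuousLinearMap.compL ℂ _ _ _ (projMul c' d')).comp (projMul c d) =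
      ((ContinuousLinearMap.compL ℂ (ProjTensor E₃ F₃) (ProjTensor E₂₃ F₂₃)
        (ProjTensor E F)).bilinearComp (projMul e' k') (projMul e k)) :=
    projTensor_ext₂ h₁
  exact DFunLike.congr_fun (DFunLike.congr_fun (DFunLike.congr_fun h₂ u) v) w

end ProjMul

/-! ### Associativity and contractivity of vector-valued convolution -/

section Convolution

variable {G : Type*} [Group G] [TopologicalSpace G] [MeasurableSpace G]
  [IsTopologicalGroup G] [LocallyCompactSpace G] [BorelSpace G]
  (ω : Weight G) (μ : Measure G) [μ.IsHaarMeasure]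
  {E F H P Q Z : Type*} [NormedAddCommGroup E] [NormedSpace ℂ E]
  [NormedAddCommGroup F] [NormedSpace ℂ F] [NormedAddCommGroup H] [NormedSpace ℂ H]
  [NormedAddCommGroup P] [NormedSpace ℂ P] [CompleteSpace P]
  [NormedAddCommGroup Q] [NormedSpace ℂ Q] [CompleteSpace Q]
  [NormedAddCommGroup Z] [NormedSpace ℂ Z] [CompleteSpace Z]
  {B : E →L[ℂ] F →L[ℂ] P} {B' : P →L[ℂ] H →L[ℂ] Z}
  {D : F →L[ℂ] H →L[ℂ] Q} {D' : E →L[ℂ] Q →L[ℂ] Z}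

/-- Associativity of convolution on functions with compact support. The Haar measure need not be
σ-finite, and Fubini's theorem is available because the integrand is compactly supported. -/
theorem ccConv_assoc (h : ∀ x y z, B' (B x y) z = D' x (D y z))
    (f : C_c(G, E)) (g : C_c(G, F)) (k : C_c(G, H)) :
    ccConv μ B' (ccConv μ B f g) k = ccConv μ D' f (ccConv μ D g k) := by
  ext s
  have hf := f.continuous
  have hg := g.continuous
  have hk := k.continuous
  let Φ : G → G → Z := fun t r => D' (f r) (D (g (r⁻¹ * t)) (k (t⁻¹ * s)))
  have hΦc : Continuous Φ.uncurry := by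
    simp only [Φ, Function.uncurry_def]
    fun_prop
  have hΦs : HasCompactSupport Φ.uncurry := by
    refine HasCompactSupport.intro
      ((f.hasCompactSupport.mul g.hasCompactSupport).prod f.hasCompactSupport) fun p hp => ?_
    by_contra h
    refine hp ?_
    have h1 : p.2 ∈ tsupport f := by
      by_contra ht
      exact h (by simp [Φ, Function.uncurry_def, image_eq_zero_of_notMem_tsupport ht])
    have h2 : p.2⁻¹ * p.1 ∈ tsupport g := by
      by_contra ht
      exact h (by simp [Φ, Function.uncurry_def, image_eq_zero_of_notMem_tsupport ht])
    exact ⟨⟨p.2, h1, _, h2, by simp⟩, h1⟩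
  calc ccConv μ B' (ccConv μ B f g) k s
      = ∫ t, ∫ r, Φ t r ∂μ ∂μ := by
        rw [ccConv_apply]
        refine integral_congr_ae (Filter.Eventually.of_forall fun t => ?_)
        have := (B'.flip (k (t⁻¹ * s))).integral_comp_comm (ccConv_integrable μ B f g t)
        simp only [ContinuousLinearMap.flip_apply, h] at this
        exact this.symm
    _ = ∫ r, ∫ t, Φ t r ∂μ ∂μ := integral_integral_swap_of_hasCompactSupport hΦc hΦs
    _ = ∫ r, ∫ t, D' (f r) (D (g t) (k (t⁻¹ * (r⁻¹ * s)))) ∂μ ∂μ := by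
        congr 1 with r
        rw [← integral_mul_left_eq_self _ r]
        simp only [Φ, inv_mul_cancel_left, mul_inv_rev, mul_assoc]
    _ = ccConv μ D' f (ccConv μ D g k) s := by
        rw [ccConv_apply]
        congr 1 with r
        exact (D' (f r)).integral_comp_comm (ccConv_integrable μ D g k (r⁻¹ * s))

variable [μ.Regular]

theorem norm_conv_apply_le (D : E →L[ℂ] F →L[ℂ] Z) (u : L1W ω μ E) (v : L1W ω μ F) :
    ‖conv ω μ D u v‖ ≤ ‖D‖ * ‖u‖ * ‖v‖ := by
  refine (denseRange_ccToL1 (X := E) ω μ).induction_on u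
    (isClosed_le (by fun_prop) (by fun_prop)) fun f => ?_
  refine (denseRange_ccToL1 (X := F) ω μ).induction_on v
    (isClosed_le (by fun_prop) (by fun_prop)) fun g => ?_
  rw [conv_cc]
  exact norm_ccConv_le ω μ D f g

theorem conv_assoc (h : ∀ x y z, B' (B x y) z = D' x (D y z))
    (u : L1W ω μ E) (v : L1W ω μ F) (w : L1W ω μ H) :
    conv ω μ B' (conv ω μ B u v) w = conv ω μ D' u (conv ω μ D v w) := by
  refine (denseRange_ccToL1 (X := E) ω μ).induction_on u
    (isClosed_eq (by fun_prop) (by fun_prop)) fun f => ?_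
  refine (denseRange_ccToL1 (X := F) ω μ).induction_on v
    (isClosed_eq (by fun_prop) (by fun_prop)) fun g => ?_
  refine (denseRange_ccToL1 (X := H) ω μ).induction_on w
    (isClosed_eq (by fun_prop) (by fun_prop)) fun k => ?_
  rw [conv_cc, conv_cc, conv_cc, conv_cc, ccConv_assoc μ h]

end Convolution

/-! ### Convolution of elementary tensors -/

section ElementaryTensors

variable {G : Type*} [Group G] [TopologicalSpace G] [MeasurableSpace G]
  [IsTopologicalGroup G] [LocallyCompactSpace G] [BorelSpace G]
  (ω : Weight G) (μ : Measure G) [μ.IsHaarMeasure]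
  {E F Z : Type*} [NormedAddCommGroup E] [NormedSpace ℂ E]
  [NormedAddCommGroup F] [NormedSpace ℂ F] [NormedAddCommGroup Z] [NormedSpace ℂ Z]

/-- The compactly supported function `t ↦ f(t) y`. -/
noncomputable def ccSmulConst (f : C_c(G, ℂ)) (y : E) : C_c(G, E) :=
  ⟨⟨fun t => f t • y, f.continuous.smul continuous_const⟩, f.hasCompactSupport.smul_right⟩

theorem smulConst_ccToL1 (f : C_c(G, ℂ)) (y : E) :
    smulConst (weightedMeasure ω μ) E (ccToL1 ω μ f) y = ccToL1 ω μ (ccSmulConst f y) := by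
  ext1
  filter_upwards [coeFn_smulConst (ccToL1 ω μ f) y, (memLp_of_cc ω μ f).coeFn_toLp,
    (memLp_of_cc ω μ (ccSmulConst f y)).coeFn_toLp] with t h₁ h₂ h₃
  exact h₁.trans ((congrArg (· • y) h₂).trans h₃.symm)

variable [CompleteSpace Z]

theorem ccConv_ccSmulConst (D : E →L[ℂ] F →L[ℂ] Z) (f g : C_c(G, ℂ)) (y : E) (z : F) :
    ccConv μ D (ccSmulConst f y) (ccSmulConst g z) =
      ccSmulConst (ccConv μ (ContinuousLinearMap.mul ℂ ℂ) f g) (D y z) := by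
  ext s
  change ∫ t, D (f t • y) (g (t⁻¹ * s) • z) ∂μ = (∫ t, f t * g (t⁻¹ * s) ∂μ) • D y z
  rw [← integral_smul_const]
  simp only [map_smul, smul_apply, smul_smul, mul_comm]

variable [μ.Regular]

/-- `(f y) * (g z) = (f * g) D(y, z)` for scalar-valued `f`, `g` and vectors `y`, `z`. -/
theorem conv_smulConst (D : E →L[ℂ] F →L[ℂ] Z) (f g : L1W ω μ ℂ) (y : E) (z : F) :
    conv ω μ D (smulConst (weightedMeasure ω μ) E f y) (smulConst (weightedMeasure ω μ) F g z) =
      smulConst (weightedMeasure ω μ) Z (conv ω μ (ContinuousLinearMap.mul ℂ ℂ) f g) (D y z) := by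
  refine (denseRange_ccToL1 (X := ℂ) ω μ).induction_on f
    (isClosed_eq (by fun_prop) (by fun_prop)) fun f => ?_
  refine (denseRange_ccToL1 (X := ℂ) ω μ).induction_on g
    (isClosed_eq (by fun_prop) (by fun_prop)) fun g => ?_
  rw [smulConst_ccToL1, smulConst_ccToL1, conv_cc, conv_cc, smulConst_ccToL1, ccConv_ccSmulConst]

/-- The canonical maps `α` turn products of tensors into convolutions. -/
theorem alpha_projMul [CompleteSpace E] [CompleteSpace F] (D : E →L[ℂ] F →L[ℂ] Z)
    (u : ProjTensor (L1W ω μ ℂ) E) (v : ProjTensor (L1W ω μ ℂ) F) :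
    alpha ω μ Z (projMul (conv ω μ (ContinuousLinearMap.mul ℂ ℂ)) D u v) =
      conv ω μ D (alpha ω μ E u) (alpha ω μ F v) := by
  have h : (ContinuousLinearMap.compL ℂ _ _ _ (alpha ω μ Z)).comp
      (projMul (conv ω μ (ContinuousLinearMap.mul ℂ ℂ)) D) =
      (conv ω μ D).bilinearComp (alpha ω μ E) (alpha ω μ F) := by
    refine projTensor_ext₂ fun f y g z => ?_
    change alpha ω μ Z (projMul _ D (ptmul f y) (ptmul g z)) =
      conv ω μ D (alpha ω μ E (ptmul f y)) (alpha ω μ F (ptmul g z))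
    rw [projMul_ptmul, alpha_ptmul_eq, alpha_ptmul_eq, alpha_ptmul_eq, conv_smulConst]
  exact DFunLike.congr_fun (DFunLike.congr_fun h u) v

theorem norm_tensorMul_apply_le (D : E →L[ℂ] F →L[ℂ] F)
    (u : ProjTensor (L1W ω μ ℂ) E) (v : ProjTensor (L1W ω μ ℂ) F) :
    ‖tensorMul ω μ D u v‖ ≤ ‖D‖ * ‖u‖ * ‖v‖ := by
  have h : ‖conv ω μ (ContinuousLinearMap.mul ℂ ℂ)‖ ≤ 1 :=
    ContinuousLinearMap.opNorm_le_bound₂ _ zero_le_one fun f g =>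
      (norm_conv_apply_le ω μ _ f g).trans
        (by gcongr; exact ContinuousLinearMap.opNorm_mul_le ℂ ℂ)
  refine (norm_projMul_apply_le _ D u v).trans ?_
  gcongr
  exact mul_le_of_le_one_left (norm_nonneg D) h

end ElementaryTensors



end Beurling

/-! ### The Banach algebra and module structures -/

theorem theoremT {G : Type*} [Group G] [TopologicalSpace G] [IsTopologicalGroup G]
    [LocallyCompactSpace G] [MeasurableSpace G] [BorelSpace G]
    (μ : Measure G) [μ.IsHaarMeasure] [μ.Regular] (ω : Beurling.Weight G)
    {A : Type*} [NonUnitalNormedRing A] [NormedSpace ℂ A] [IsScalarTower ℂ A A]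
    [SMulCommClass ℂ A A] [CompleteSpace A]
    {X : Type*} [NormedAddCommGroup X] [NormedSpace ℂ X] [CompleteSpace X]
    (ρ : A →L[ℂ] X →L[ℂ] X) (hρ : ∀ a b x, ρ (a * b) x = ρ a (ρ b x)) :
    -- `L¹_ω(G) ⊗̂ A` and `L¹_ω(G, A)` are Banach algebras
    (Beurling.IsBanachAlgebraMul (Beurling.tensorMul ω μ (ContinuousLinearMap.mul ℂ A)) ∧
      Beurling.IsBanachAlgebraMul (Beurling.conv ω μ (ContinuousLinearMap.mul ℂ A))) ∧
    -- `L¹_ω(G) ⊗̂ X` and `L¹_ω(G, X)` are Banach left modules over them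
    (Beurling.IsBanachLeftModule (Beurling.tensorMul ω μ (ContinuousLinearMap.mul ℂ A))
        (Beurling.tensorMul ω μ ρ) ‖ρ‖ ∧
      Beurling.IsBanachLeftModule (Beurling.conv ω μ (ContinuousLinearMap.mul ℂ A))
        (Beurling.conv ω μ ρ) ‖ρ‖) ∧
    -- `α_X (u v) = α_A (u) * α_X (v)`
    (∀ (u : Beurling.ProjTensor (Beurling.L1W ω μ ℂ) A)
        (v : Beurling.ProjTensor (Beurling.L1W ω μ ℂ) X),
      Beurling.alpha ω μ X (Beurling.tensorMul ω μ ρ u v) =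
        Beurling.conv ω μ ρ (Beurling.alpha ω μ A u) (Beurling.alpha ω μ X v)) ∧
    -- `α_A` is an isometric algebra isomorphism onto `L¹_ω(G, A)`
    (Isometry (Beurling.alpha ω μ A) ∧ Function.Surjective (Beurling.alpha ω μ A) ∧
      ∀ u v : Beurling.ProjTensor (Beurling.L1W ω μ ℂ) A,
        Beurling.alpha ω μ A (Beurling.tensorMul ω μ (ContinuousLinearMap.mul ℂ A) u v) =
          Beurling.conv ω μ (ContinuousLinearMap.mul ℂ A)
            (Beurling.alpha ω μ A u) (Beurling.alpha ω μ A v)) := by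
  have hA (a b c : A) : ContinuousLinearMap.mul ℂ A (ContinuousLinearMap.mul ℂ A a b) c =
      ContinuousLinearMap.mul ℂ A a (ContinuousLinearMap.mul ℂ A b c) := mul_assoc a b c
  have hℂ (f g h : Beurling.L1W ω μ ℂ) :
      Beurling.conv ω μ (.mul ℂ ℂ) (Beurling.conv ω μ (.mul ℂ ℂ) f g) h =
        Beurling.conv ω μ (.mul ℂ ℂ) f (Beurling.conv ω μ (.mul ℂ ℂ) g h) :=
    Beurling.conv_assoc ω μ (fun x y z => mul_assoc x y z) f g h
  have hmul : ‖ContinuousLinearMap.mul ℂ A‖ ≤ 1 := ContinuousLinearMap.opNorm_mul_le ℂ A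
  refine ⟨⟨⟨Beurling.projMul_assoc hℂ hA, fun u v => ?_⟩,
      ⟨Beurling.conv_assoc ω μ hA, fun u v => ?_⟩⟩,
    ⟨⟨Beurling.projMul_assoc hℂ hρ, Beurling.norm_tensorMul_apply_le ω μ ρ⟩,
      ⟨Beurling.conv_assoc ω μ hρ, Beurling.norm_conv_apply_le ω μ ρ⟩⟩,
    Beurling.alpha_projMul ω μ ρ,
    Beurling.isometry_alpha ω μ, Beurling.surjective_alpha ω μ,
    Beurling.alpha_projMul ω μ (.mul ℂ A)⟩
  · refine (Beurling.norm_tensorMul_apply_le ω μ _ u v).trans ?_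
    rw [mul_assoc]
    exact mul_le_of_le_one_left (by positivity) hmul
  · refine (Beurling.norm_conv_apply_le ω μ _ u v).trans ?_
    rw [mul_assoc]
    exact mul_le_of_le_one_left (by positivity) hmul
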